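/- Let $n\ge 1$, let $\alpha$ be a primitive element of $\mathbb F_{2^n}$, and let $C$ be the binary cyclic code of length $2^n-1$ with defining set $\{1,7\}$, i.e. the set of words $(c_0,\dots,c_{2^n-2})\in\mathbb F_2^{2^n-1}$ whose polynomial $c(X)=\sum_i c_iX^i$ satisfies $c(\alpha)=c(\alpha^7)=0$. Let $B_3$ and $B_4$ be the numbers of codewords of $C$ of Hamming weight $3$ and $4$. Let $$K(1)=\sum_{x\in\mathbb F_{2^n}}(-1)^{\mathrm{Tr}(x^{-1}+x)},$$ where $\mathrm{Tr}$ is the absolute trace $\mathbb F_{2^n}\to\mathbb F_2$ and the term at $x=0$ is taken to be $1$. Then: - if $n$ is odd, $B_3=0$ and $B_4=(2^n-1)\left(\dfrac{2^{n-2}+1}{6}-\dfrac{K(1)}{8}\right)$; - if $n$ is even, $B_3=\dfrac{2^n-1}{3}$ and $B_4=(2^n-1)\left(\dfrac{2^{n-2}-4}{6}+\dfrac{K(1)}{8}\right)$. -/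

import Mathlib

open Polynomial

noncomputable section

/-- The binary cyclic code of length `N` with defining set `S` relative to `α` (an `N`-th root of
unity, in applications a primitive one) in an extension field `F` of the binary field: the words
`c = (c₀, …, c_{N-1})` whose associated polynomial `c(X) = ∑ cᵢ X ^ i` vanishes at `α ^ s` for
every `s ∈ S`. -/
def binaryCyclicCode {F : Type*} [Field F] [Algebra (ZMod 2) F] (N : ℕ) (α : F) (S : Set ℕ) :
    Submodule (ZMod 2) (Fin N → ZMod 2) where
  carrier := {c | ∀ s ∈ S, aeval (α ^ s) (Polynomial.ofFn N c) = 0}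
  add_mem' := by
    intro a b ha hb s hs
    rw [map_add, map_add, ha s hs, hb s hs, add_zero]
  zero_mem' := by
    intro s _
    rw [map_zero, map_zero]
  smul_mem' := by
    intro r a ha s hs
    rw [map_smul, map_smul, ha s hs, smul_zero]

/-- The number of codewords of Hamming weight `w` in a binary code of length `N`. -/
def numCodewordsOfWeight {N : ℕ} (C : Submodule (ZMod 2) (Fin N → ZMod 2)) (w : ℕ) : ℕ :=
  Set.ncard {c : Fin N → ZMod 2 | c ∈ C ∧ hammingNorm c = w}

/-- The Kloosterman sum `K(a) = ∑_{x ∈ F} (-1) ^ Tr(x⁻¹ + a x)` over a finite field `F` of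
characteristic two, with `Tr` the absolute trace. The term at `x = 0` is `1`, since `0⁻¹ = 0`. -/
def binaryKloostermanSum {F : Type*} [Field F] [Fintype F] [Algebra (ZMod 2) F] (a : F) : ℤ :=
  ∑ x : F, (-1) ^ (Algebra.trace (ZMod 2) F (x⁻¹ + a * x)).val

end

/-!
Write `q` for the order of `F`, `χ(x) = (-1) ^ Tr x` and `K = K(1)`. The powers `α ^ i` run through
the nonzero elements of `F`, so a codeword of weight `w` is a set of `w` distinct nonzero elements
whose sum and whose sum of seventh powers vanish
(`numCodewordsOfWeight_mul_factorial`, which passes to ordered `w`-tuples).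

For weight three, a zero-sum triple is `l • (1, u, u + 1)`, and the condition on seventh powers
becomes `u² + u = 1`. This has `1 + χ(1)` solutions, so `6 B₃ = (q - 1) (1 + χ(1))`.

For weight four, a zero-sum quadruple is `l • (a, a + 1, b, b + 1)` with `l` the sum of its first two
entries. Since `a⁷ + (a + 1)⁷ = 1 + A + A³` for `A = a² + a`, the condition says that `A` and
`B = b² + b` satisfy `A + A³ = B + B³`; as the entries are nonzero and distinct exactly when `A`,
`B` and `A + B` are nonzero, `(A, B)` is a point of the conic `A² + AB + B² = 1` other than
`(0, 1)`, `(1, 0)`, `(1, 1)` (`card_quadruples`). Each `A` is of the form `a² + a` in `1 + χ(A)` ways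
(`card_sq_add_self_eq`), so the number of pairs `(a, b)` is the sum of
`(1 + χ(A)) (1 + χ(B)) = 1 + χ(A) + χ(B) + χ(A + B)` over those points.

The conic has `q - χ(1)` points. For `A ≠ 0` the number of its points above `A` is
`1 + χ(1) χ(A⁻¹)`, which makes the sum of `χ(A)` equal to `χ(1) (K - 1)`. The symmetries
`(A, B) ↦ (B, A)` and `(A, B) ↦ (A, A + B)` of the conic give the same value for the sums of `χ(B)`
and `χ(A + B)`. Each of the three excluded points contributes `2 (1 + χ(1))`, so
`24 B₄ = (q - 1) (q - χ(1) + 3 χ(1) (K - 1) - 6 (1 + χ(1)))`, and `χ(1) = (-1) ^ n`.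
-/

/-! ### Signs of the absolute trace -/

/-- The additive character `x ↦ (-1) ^ Tr x` of a finite field of characteristic two. -/
noncomputable def traceSign {F : Type*} [Field F] [Algebra (ZMod 2) F] (x : F) : ℤ :=
  (-1) ^ (Algebra.trace (ZMod 2) F x).val

section TraceSign

variable {F : Type*} [Field F] [Algebra (ZMod 2) F]

theorem charP_two_of_algebra (F : Type*) [Field F] [Algebra (ZMod 2) F] : CharP F 2 :=
  charP_of_injective_algebraMap (algebraMap (ZMod 2) F).injective 2

theorem traceSign_zero : traceSign (0 : F) = 1 := by
  simp [traceSign]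

theorem traceSign_add (x y : F) : traceSign (x + y) = traceSign x * traceSign y := by
  have h : ∀ a b : ZMod 2, (-1 : ℤ) ^ (a + b).val = (-1) ^ a.val * (-1) ^ b.val := by decide
  rw [traceSign, map_add, h]
  rfl

theorem traceSign_sq [Fintype F] (x : F) : traceSign (x ^ 2) = traceSign x := by
  have h := Algebra.trace_eq_of_algEquiv (FiniteField.frobeniusAlgEquivOfAlgebraic (ZMod 2) F) x
  simp only [FiniteField.frobeniusAlgEquivOfAlgebraic_apply, ZMod.card] at h
  rw [traceSign, h, traceSign]

theorem traceSign_eq_one_or (x : F) : traceSign x = 1 ∨ traceSign x = -1 :=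
  neg_one_pow_eq_or ℤ _

theorem traceSign_one [Fintype F] {n : ℕ} (hF : Fintype.card F = 2 ^ n) :
    traceSign (1 : F) = (-1) ^ n := by
  have hn : Module.finrank (ZMod 2) F = n := by
    have h := Module.card_eq_pow_finrank (K := ZMod 2) (V := F)
    rw [hF, ZMod.card] at h
    exact (Nat.pow_right_injective le_rfl h).symm
  have h1 : Algebra.trace (ZMod 2) F 1 = (n : ZMod 2) := by
    simpa [hn] using Algebra.trace_algebraMap (S := F) (1 : ZMod 2)
  rw [traceSign, h1, ZMod.val_natCast, ← neg_one_pow_eq_pow_mod_two]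

theorem sum_traceSign [Fintype F] : ∑ x : F, traceSign x = 0 := by
  obtain ⟨y, hy⟩ := Algebra.trace_surjective (ZMod 2) F 1
  have hy' : traceSign y = -1 := by
    rw [traceSign, hy]
    rfl
  have h := Equiv.sum_comp (Equiv.addRight y) (fun x : F => traceSign x)
  simp only [Equiv.coe_addRight, traceSign_add, hy', mul_neg, mul_one, Finset.sum_neg_distrib] at h
  linarith

theorem sum_traceSign_inv [Fintype F] : ∑ x : F, traceSign x⁻¹ = 0 :=
  (Equiv.sum_comp (Equiv.inv F) (fun x : F => traceSign x)).trans sum_traceSign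

theorem binaryKloostermanSum_one_eq [Fintype F] :
    binaryKloostermanSum (1 : F) = ∑ x : F, traceSign x * traceSign x⁻¹ := by
  refine Finset.sum_congr rfl fun x _ => ?_
  rw [← traceSign_add, one_mul, add_comm]
  rfl

open Classical in
/-- The Artin–Schreier equation `u² + u = c` has `1 + (-1) ^ Tr c` solutions. The right-hand side
bounds the number of solutions for each `c`, and both sides sum to the order of the field. -/
theorem card_sq_add_self_eq [Fintype F] (c : F) :
    (({u : F | u ^ 2 + u = c} : Finset F).card : ℤ) = 1 + traceSign c := by
  have := charP_two_of_algebra F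
  -- A solution `u` forces `Tr c = Tr (u²) + Tr u = 0`, and then `u`, `u + 1` are all solutions.
  have hle : ∀ c ∈ (Finset.univ : Finset F),
      (({u : F | u ^ 2 + u = c} : Finset F).card : ℤ) ≤ 1 + traceSign c := by
    intro c _
    rcases ({u : F | u ^ 2 + u = c} : Finset F).eq_empty_or_nonempty with h | ⟨u, hu⟩
    · rw [h]
      rcases traceSign_eq_one_or c with h | h <;> simp [h]
    · have hu : u ^ 2 + u = c := by simpa using hu
      have hc : traceSign c = 1 := by
        rw [← hu, traceSign_add, traceSign_sq]
        rcases traceSign_eq_one_or u with h | h <;> simp [h]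
      have hsub : ({u : F | u ^ 2 + u = c} : Finset F) ⊆ {u, u + 1} := by
        intro v hv
        have hv : v ^ 2 + v = c := by simpa using hv
        have : (v - u) * (v - (u + 1)) = 0 := by
          grind
        rcases mul_eq_zero.mp this with h | h
        · simp [sub_eq_zero.mp h]
        · simp [sub_eq_zero.mp h]
      have := (Finset.card_le_card hsub).trans Finset.card_le_two
      rw [hc]
      exact_mod_cast this
  refine (Finset.sum_eq_sum_iff_of_le hle).mp ?_ c (Finset.mem_univ c)
  rw [Finset.sum_add_distrib, sum_traceSign, add_zero, ← Nat.cast_sum,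
    ← Finset.card_eq_sum_card_fiberwise (f := fun u : F => u ^ 2 + u) (by simp)]
  simp

/-- Change of variables `A = a² + a`, weighted by the number of preimages. -/
theorem sum_comp_sq_add_self [Fintype F] (g : F → ℤ) :
    ∑ a : F, g (a ^ 2 + a) = ∑ A : F, g A * (1 + traceSign A) := by
  classical
  rw [← Finset.sum_fiberwise Finset.univ (fun a : F => a ^ 2 + a)]
  refine Finset.sum_congr rfl fun A _ => ?_
  rw [← card_sq_add_self_eq, Finset.sum_congr rfl (g := fun _ => g A), Finset.sum_const,
    nsmul_eq_mul, mul_comm]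
  intro a ha
  rw [(Finset.mem_filter.mp ha).2]

end TraceSign

/-! ### The conic `A² + AB + B² = 1` -/

section Conic

variable {F : Type*} [Field F] [Algebra (ZMod 2) F]

open Classical in
/-- The number of points of the conic above a given abscissa: for `A ≠ 0` the substitution `B = A u`
turns the equation into `u² + u = 1 + A⁻²`. -/
theorem card_conic_fiber [Fintype F] (A : F) :
    ∑ B : F, (if A ^ 2 + A * B + B ^ 2 = 1 then 1 else 0 : ℤ) =
      1 + traceSign (1 : F) * traceSign A⁻¹ - if A = 0 then traceSign (1 : F) else 0 := by
  have := charP_two_of_algebra F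
  by_cases hA : A = 0
  · subst hA
    have h : ∀ B : F, (0 : F) ^ 2 + 0 * B + B ^ 2 = 1 ↔ B = 1 := fun B => by
      rw [← CharTwo.sq_inj (x := B)]
      ring_nf
    simp only [h]
    simp [traceSign_zero]
  · rw [if_neg hA, sub_zero, ← traceSign_sq A⁻¹, ← traceSign_add, ← card_sq_add_self_eq,
      ← Equiv.sum_comp (Equiv.mulLeft₀ A hA), Finset.sum_boole]
    congr 2
    ext u
    simp only [Equiv.mulLeft₀_apply, Finset.mem_filter, Finset.mem_univ, true_and]
    constructor
    · intro h
      field_simp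
      grind
    · intro h
      field_simp at h
      grind

open Classical in
/-- The sum over the conic of a function of the abscissa. -/
theorem sum_conic [Fintype F] (f : F → ℤ) :
    ∑ A : F, ∑ B : F, (if A ^ 2 + A * B + B ^ 2 = 1 then 1 else 0) * f A =
      ∑ A : F, f A + traceSign (1 : F) * ∑ A : F, f A * traceSign A⁻¹
        - traceSign (1 : F) * f 0 := by
  simp_rw [← Finset.sum_mul, card_conic_fiber, sub_mul, Finset.sum_sub_distrib, add_mul,
    Finset.sum_add_distrib, ite_mul, Finset.mul_sum]
  simp [mul_assoc, mul_comm]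

open Classical in
theorem card_conic [Fintype F] :
    ∑ A : F, ∑ B : F, (if A ^ 2 + A * B + B ^ 2 = 1 then 1 else 0 : ℤ) =
      Fintype.card F - traceSign (1 : F) := by
  simpa [sum_traceSign_inv] using sum_conic (fun _ : F => 1)

open Classical in
theorem sum_conic_traceSign_left [Fintype F] :
    ∑ A : F, ∑ B : F, (if A ^ 2 + A * B + B ^ 2 = 1 then 1 else 0) * traceSign A =
      traceSign (1 : F) * (binaryKloostermanSum (1 : F) - 1) := by
  rw [sum_conic, sum_traceSign, ← binaryKloostermanSum_one_eq, traceSign_zero]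
  ring

open Classical in
theorem sum_conic_traceSign_right [Fintype F] :
    ∑ A : F, ∑ B : F, (if A ^ 2 + A * B + B ^ 2 = 1 then 1 else 0) * traceSign B =
      traceSign (1 : F) * (binaryKloostermanSum (1 : F) - 1) := by
  rw [← sum_conic_traceSign_left, Finset.sum_comm]
  refine Finset.sum_congr rfl fun A _ => Finset.sum_congr rfl fun B _ => ?_
  rw [show B ^ 2 + B * A + A ^ 2 = A ^ 2 + A * B + B ^ 2 by ring]

open Classical in
/-- The map `(A, B) ↦ (A, A + B)` preserves the conic in characteristic two. -/
theorem sum_conic_traceSign_add [Fintype F] :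
    ∑ A : F, ∑ B : F, (if A ^ 2 + A * B + B ^ 2 = 1 then 1 else 0) * traceSign (A + B) =
      traceSign (1 : F) * (binaryKloostermanSum (1 : F) - 1) := by
  have := charP_two_of_algebra F
  rw [← sum_conic_traceSign_right]
  refine Finset.sum_congr rfl fun A _ => ?_
  rw [← Equiv.sum_comp (Equiv.addLeft A)]
  refine Finset.sum_congr rfl fun B _ => ?_
  have h : A ^ 2 + A * (A + B) + (A + B) ^ 2 = A ^ 2 + A * B + B ^ 2 := by grind
  simp only [Equiv.coe_addLeft, CharTwo.add_cancel_left, h]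

open Classical in
/-- The points of the conic with `A = 0`, `B = 0` or `A = B` are `(0, 1)`, `(1, 0)`, `(1, 1)`. -/
theorem conic_nondegenerate_indicator (A B : F) :
    (if A ^ 2 + A * B + B ^ 2 = 1 ∧ A ≠ 0 ∧ B ≠ 0 ∧ A ≠ B then 1 else 0 : ℤ) =
      (if A ^ 2 + A * B + B ^ 2 = 1 then 1 else 0) - (if A = 0 then if B = 1 then 1 else 0 else 0)
        - (if A = 1 then if B = 0 then 1 else 0 else 0)
        - (if A = 1 then if B = 1 then 1 else 0 else 0) := by
  have := charP_two_of_algebra F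
  have hsq : ∀ x : F, x ^ 2 = 1 ↔ x = 1 := fun x => by
    rw [← CharTwo.sq_inj (x := x), one_pow]
  have h2 : (1 : F) + 1 = 0 := CharTwo.add_self_eq_zero 1
  by_cases hA : A = 0
  · subst hA
    simp [hsq]
  by_cases hB : B = 0
  · subst hB
    simp [hsq]
  by_cases hAB : A = B
  · subst hAB
    have h : A ^ 2 + A * A + A ^ 2 = 1 ↔ A = 1 := by
      rw [← hsq A, show A ^ 2 + A * A + A ^ 2 = A ^ 2 by grind]
    by_cases h1 : A = 1 <;> simp [h1, h, h2]
  · have h1 : ¬ (A = 1 ∧ B = 1) := fun h => hAB (h.1.trans h.2.symm)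
    by_cases hA1 : A = 1 <;> simp_all

open Classical in
/-- The number of pairs `(a, b)` for which `(a² + a, b² + b)` is a nondegenerate point of the
conic. -/
theorem card_pairs_over_conic [Fintype F] :
    ∑ a : F, ∑ b : F, (if (a ^ 2 + a) ^ 2 + (a ^ 2 + a) * (b ^ 2 + b) + (b ^ 2 + b) ^ 2 = 1 ∧
        a ^ 2 + a ≠ 0 ∧ b ^ 2 + b ≠ 0 ∧ a ^ 2 + a ≠ b ^ 2 + b then 1 else 0 : ℤ) =
      Fintype.card F - traceSign (1 : F)
        + 3 * traceSign (1 : F) * (binaryKloostermanSum (1 : F) - 1)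
        - 6 * (1 + traceSign (1 : F)) := by
  have hone : traceSign (1 : F) ^ 2 = 1 := by
    rcases traceSign_eq_one_or (1 : F) with h | h <;> simp [h]
  rw [sum_comp_sq_add_self (fun A => ∑ b : F, (if A ^ 2 + A * (b ^ 2 + b) + (b ^ 2 + b) ^ 2 = 1 ∧
    A ≠ 0 ∧ b ^ 2 + b ≠ 0 ∧ A ≠ b ^ 2 + b then 1 else 0 : ℤ))]
  have hB : ∀ A : F, ∑ b : F, (if A ^ 2 + A * (b ^ 2 + b) + (b ^ 2 + b) ^ 2 = 1 ∧
      A ≠ 0 ∧ b ^ 2 + b ≠ 0 ∧ A ≠ b ^ 2 + b then 1 else 0 : ℤ) =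
      ∑ B : F, (if A ^ 2 + A * B + B ^ 2 = 1 ∧ A ≠ 0 ∧ B ≠ 0 ∧ A ≠ B then 1 else 0)
        * (1 + traceSign B) := fun A =>
    sum_comp_sq_add_self
      (fun B => if A ^ 2 + A * B + B ^ 2 = 1 ∧ A ≠ 0 ∧ B ≠ 0 ∧ A ≠ B then 1 else 0)
  simp_rw [hB, conic_nondegenerate_indicator, Finset.sum_mul]
  -- `χ(A) χ(B) = χ(A + B)` for the trace sign `χ`.
  have hexp : ∀ A B : F, ((if A ^ 2 + A * B + B ^ 2 = 1 then 1 else 0)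
        - (if A = 0 then if B = 1 then 1 else 0 else 0)
        - (if A = 1 then if B = 0 then 1 else 0 else 0)
        - (if A = 1 then if B = 1 then 1 else 0 else 0) : ℤ) * (1 + traceSign B)
          * (1 + traceSign A) =
      (if A ^ 2 + A * B + B ^ 2 = 1 then 1 else 0)
        + (if A ^ 2 + A * B + B ^ 2 = 1 then 1 else 0) * traceSign A
        + (if A ^ 2 + A * B + B ^ 2 = 1 then 1 else 0) * traceSign B
        + (if A ^ 2 + A * B + B ^ 2 = 1 then 1 else 0) * traceSign (A + B)
        - (if A = 0 then if B = 1 then (1 + traceSign B) * (1 + traceSign A) else 0 else 0)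
        - (if A = 1 then if B = 0 then (1 + traceSign B) * (1 + traceSign A) else 0 else 0)
        - (if A = 1 then if B = 1 then (1 + traceSign B) * (1 + traceSign A) else 0 else 0) := by
    intro A B
    rw [traceSign_add]
    split_ifs <;> ring
  simp_rw [hexp, Finset.sum_sub_distrib, Finset.sum_add_distrib]
  rw [card_conic, sum_conic_traceSign_left, sum_conic_traceSign_right, sum_conic_traceSign_add]
  have hδ : ∀ c d : F, ∑ A : F, ∑ B : F,
      (if A = c then if B = d then (1 + traceSign B) * (1 + traceSign A) else 0 else 0) =
        (1 + traceSign d) * (1 + traceSign c) := by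
    intro c d
    rw [Finset.sum_eq_single c (by intro A _ h; simp [h]) (by simp)]
    simp
  rw [hδ, hδ, hδ, traceSign_zero]
  linear_combination -hone

end Conic

/-! ### Codewords as sets of field elements -/

section Codewords

/-- A set of `k` elements has `k!` enumerations. -/
theorem card_finset_mul_factorial {X : Type*} [Fintype X] [DecidableEq X] (k : ℕ)
    (P : Finset X → Prop) [DecidablePred P] :
    ({S : Finset X | S.card = k ∧ P S} : Finset (Finset X)).card * k.factorial =
      ({f : Fin k ↪ X | P (Finset.univ.map f)} : Finset (Fin k ↪ X)).card := by
  rw [Finset.card_eq_sum_card_fiberwise (f := fun f : Fin k ↪ X => Finset.univ.map f)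
    (t := ({S : Finset X | S.card = k ∧ P S} : Finset (Finset X)))
    (by intro f hf; simpa using hf)]
  rw [Finset.sum_const_nat]
  intro S hS
  obtain ⟨hk, hP⟩ : S.card = k ∧ P S := by simpa using hS
  have hcard : Fintype.card (Fin k ↪ S) = k.factorial := by
    rw [Fintype.card_embedding_eq]
    simp [hk, Nat.descFactorial_self]
  rw [← hcard, ← Finset.card_univ]
  symm
  refine Finset.card_bij (fun g _ => g.trans (Function.Embedding.subtype _)) ?_ ?_ ?_
  · intro g _
    have : Finset.univ.map (g.trans (Function.Embedding.subtype (· ∈ S))) = S := by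
      refine Finset.eq_of_subset_of_card_le (fun x hx => ?_) (by simp [hk])
      obtain ⟨i, -, rfl⟩ := Finset.mem_map.mp hx
      exact (g i).2
    simp only [Finset.mem_filter, Finset.mem_univ, true_and, this]
    exact ⟨hP, trivial⟩
  · intro g _ g' _ h
    ext i
    exact DFunLike.congr_fun h i
  · intro f hf
    have hf : Finset.univ.map f = S := (Finset.mem_filter.mp hf).2
    have hmem : ∀ i, f i ∈ S := fun i => hf ▸ Finset.mem_map_of_mem f (Finset.mem_univ i)
    exact ⟨f.codRestrict (S : Set X) hmem, Finset.mem_univ _, by ext; rfl⟩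

variable {F : Type*} [Field F] [Algebra (ZMod 2) F]

theorem aeval_ofFn_eq_sum (N : ℕ) (c : Fin N → ZMod 2) (x : F) :
    aeval x (Polynomial.ofFn N c) = ∑ i with c i ≠ 0, x ^ (i : ℕ) := by
  rw [ofFn_eq_sum_monomial, map_sum, Finset.sum_filter]
  refine Finset.sum_congr rfl fun i _ => ?_
  have h : ∀ z : ZMod 2, z = 0 ∨ z = 1 := by decide
  rcases h (c i) with h | h <;> simp [h, aeval_monomial]

open Classical in
/-- Codewords are determined by their supports, and `i ↦ α ^ i` turns supports into sets of
nonzero field elements. -/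
theorem numCodewordsOfWeight_mul_factorial [Fintype F] {N : ℕ} (hN : Fintype.card F = N + 1)
    {α : F} (hα : IsPrimitiveRoot α N) (k w : ℕ) :
    numCodewordsOfWeight (binaryCyclicCode N α {1, k}) w * w.factorial =
      ({f : Fin w ↪ F | (∀ i, f i ≠ 0) ∧ ∑ i, f i = 0 ∧ ∑ i, f i ^ k = 0} :
        Finset (Fin w ↪ F)).card := by
  have hN0 : N ≠ 0 := by
    have := Fintype.one_lt_card (α := F)
    omega
  have hinj : Function.Injective fun i : Fin N => α ^ (i : ℕ) :=
    fun i j h => Fin.ext (hα.pow_inj i.2 j.2 h)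
  let e : Fin N ↪ F := ⟨fun i => α ^ (i : ℕ), hinj⟩
  have he : ∀ i, e i = α ^ (i : ℕ) := fun _ => rfl
  have he0 : ∀ i, e i ≠ 0 := fun i => pow_ne_zero _ (hα.ne_zero hN0)
  have hsurj : ∀ x : F, x ≠ 0 → ∃ i, e i = x := by
    intro x hx
    have : NeZero N := ⟨hN0⟩
    obtain ⟨i, hi, rfl⟩ := hα.eq_pow_of_pow_eq_one (ξ := x) (by
      simpa [hN] using FiniteField.pow_card_sub_one_eq_one x hx)
    exact ⟨⟨i, hi⟩, rfl⟩
  have hcode : ∀ c : Fin N → ZMod 2, c ∈ binaryCyclicCode N α {1, k} ↔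
      ∑ x ∈ (Finset.univ.filter (c · ≠ 0)).map e, x = 0 ∧
        ∑ x ∈ (Finset.univ.filter (c · ≠ 0)).map e, x ^ k = 0 := by
    intro c
    change (∀ s ∈ ({1, k} : Set ℕ), aeval (α ^ s) (Polynomial.ofFn N c) = 0) ↔ _
    simp [aeval_ofFn_eq_sum, Finset.sum_map, he, ← pow_mul, mul_comm]
  have hcount : numCodewordsOfWeight (binaryCyclicCode N α {1, k}) w =
      ({S : Finset F | S.card = w ∧ ((∀ x ∈ S, x ≠ 0) ∧ ∑ x ∈ S, x = 0 ∧ ∑ x ∈ S, x ^ k = 0)} :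
        Finset (Finset F)).card := by
    rw [numCodewordsOfWeight, Set.ncard_eq_toFinset_card']
    refine Finset.card_bij (fun c _ => (Finset.univ.filter (c · ≠ 0)).map e) ?_ ?_ ?_
    · intro c hc
      obtain ⟨hc, hw⟩ : c ∈ binaryCyclicCode N α {1, k} ∧ hammingNorm c = w := by simpa using hc
      simp only [Finset.mem_filter, Finset.mem_univ, true_and, Finset.card_map]
      refine ⟨by rw [← hw, hammingNorm], ?_, (hcode c).mp hc⟩
      intro x hx
      obtain ⟨i, -, rfl⟩ := Finset.mem_map.mp hx
      exact he0 i
    · intro c _ d _ h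
      have h := Finset.map_injective e h
      have hz : ∀ y z : ZMod 2, (y ≠ 0 ↔ z ≠ 0) → y = z := by decide
      funext i
      exact hz _ _ (by simpa using Finset.ext_iff.mp h i)
    · intro S hS
      obtain ⟨hw, h0, hS⟩ : S.card = w ∧ ((∀ x ∈ S, x ≠ 0) ∧ ∑ x ∈ S, x = 0 ∧
        ∑ x ∈ S, x ^ k = 0) := (Finset.mem_filter.mp hS).2
      have hmap : (Finset.univ.filter
          ((fun i => if e i ∈ S then 1 else 0 : Fin N → ZMod 2) · ≠ 0)).map e = S := by
        ext x
        simp only [Finset.mem_map, Finset.mem_filter, Finset.mem_univ, true_and, ne_eq,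
          ite_eq_right_iff, one_ne_zero, imp_false, not_not]
        constructor
        · rintro ⟨i, hi, rfl⟩
          exact hi
        · intro hx
          obtain ⟨i, rfl⟩ := hsurj x (h0 x hx)
          exact ⟨i, hx, rfl⟩
      refine ⟨fun i => if e i ∈ S then 1 else 0, ?_, hmap⟩
      simp only [Set.mem_toFinset, Set.mem_ofPred_eq]
      refine ⟨(hcode _).mpr (by rwa [hmap]), ?_⟩
      rw [hammingNorm, ← Finset.card_map e, ← hw]
      exact congrArg Finset.card hmap
  rw [hcount, card_finset_mul_factorial w
    (fun S : Finset F => (∀ x ∈ S, x ≠ 0) ∧ ∑ x ∈ S, x = 0 ∧ ∑ x ∈ S, x ^ k = 0)]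
  simp [Finset.sum_map]

end Codewords

/-! ### Codewords of weight three and four -/

section LowWeight

open Classical in
theorem cast_card_erase_zero {F : Type*} [Field F] [Fintype F] :
    ((Finset.univ.erase (0 : F)).card : ℤ) = Fintype.card F - 1 := by
  rw [Finset.cast_card_erase_of_mem (Finset.mem_univ 0), Finset.card_univ]

variable {F : Type*} [Field F] [Fintype F] [Algebra (ZMod 2) F]

open Classical in
/-- The zero-sum triples of distinct nonzero elements are `l • (1, u, u + 1)` with `l ≠ 0` and
`u ≠ 0, 1`; their seventh powers add up to `l ^ 7 * (u ^ 2 + u) * (u ^ 2 + u + 1) ^ 2`. -/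
theorem card_triples :
    (({f : Fin 3 ↪ F | (∀ i, f i ≠ 0) ∧ ∑ i, f i = 0 ∧ ∑ i, f i ^ 7 = 0} :
        Finset (Fin 3 ↪ F)).card : ℤ) = (Fintype.card F - 1) * (1 + traceSign (1 : F)) := by
  have := charP_two_of_algebra F
  rw [← card_sq_add_self_eq, ← cast_card_erase_zero, ← Nat.cast_mul, ← Finset.card_product]
  congr 1
  symm
  have hsum : ∀ l u : F, l + l * u + l * (u + 1) = 0 := fun l u => by grind
  have hpow : ∀ l u : F, l ^ 7 + (l * u) ^ 7 + (l * (u + 1)) ^ 7 =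
      l ^ 7 * ((u ^ 2 + u) * (u ^ 2 + u + 1) ^ 2) := fun l u => by grind
  have hinj : ∀ l u : F, l ≠ 0 → u ^ 2 + u = 1 →
      Function.Injective ![l, l * u, l * (u + 1)] := by
    intro l u hl hu
    have h1 : l ≠ l * u := by grind
    have h2 : l ≠ l * (u + 1) := by grind
    have h3 : l * u ≠ l * (u + 1) := by grind
    intro i j hij
    fin_cases i <;> fin_cases j <;> simp_all
  refine Finset.card_bij
    (fun p hp => ⟨![p.1, p.1 * p.2, p.1 * (p.2 + 1)], hinj p.1 p.2 ?_ ?_⟩) ?_ ?_ ?_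
  · exact (Finset.mem_erase.mp (Finset.mem_product.mp hp).1).1
  · exact (Finset.mem_filter.mp (Finset.mem_product.mp hp).2).2
  · rintro ⟨l, u⟩ hp
    obtain ⟨hl, hu⟩ : l ≠ 0 ∧ u ^ 2 + u = 1 := by simpa using hp
    have hu0 : u ≠ 0 := by grind
    have hu1 : u + 1 ≠ 0 := by grind
    simp only [Finset.mem_filter, Finset.mem_univ, true_and, Function.Embedding.coeFn_mk,
      Fin.forall_fin_succ, Fin.sum_univ_three]
    refine ⟨by simp [hl, hu0, hu1], hsum l u, (hpow l u).trans ?_⟩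
    rw [hu, CharTwo.add_self_eq_zero]
    ring
  · rintro ⟨l, u⟩ hp ⟨l', u'⟩ _ h
    have hl : l ≠ 0 := (Finset.mem_erase.mp (Finset.mem_product.mp hp).1).1
    have h0 : l = l' := DFunLike.congr_fun h 0
    have h1 : l * u = l' * u' := DFunLike.congr_fun h 1
    subst h0
    rw [mul_left_cancel₀ hl h1]
  · intro f hf
    obtain ⟨hne, hs, hs7⟩ := (Finset.mem_filter.mp hf).2
    rw [Fin.sum_univ_three] at hs hs7
    obtain ⟨u, hu⟩ : ∃ u, f 1 = f 0 * u := ⟨f 1 / f 0, (mul_div_cancel₀ _ (hne 0)).symm⟩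
    have hf2 : f 2 = f 0 * (u + 1) := by grind
    have hl := hne 0
    have hu0 : u ≠ 0 := fun h => hne 1 (by rw [hu, h, mul_zero])
    have hu1 : u + 1 ≠ 0 := fun h => hne 2 (by rw [hf2, h, mul_zero])
    rw [hu, hf2, hpow] at hs7
    have hu' : u ^ 2 + u + 1 = 0 := by
      have : u ^ 2 + u = u * (u + 1) := by ring
      simpa [hl, this, hu0, hu1] using hs7
    refine ⟨(f 0, u), ?_, ?_⟩
    · simpa [hl] using CharTwo.add_eq_zero.mp hu'
    · ext i
      fin_cases i
      · rfl
      · exact hu.symm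
      · exact hf2.symm

open Classical in
/-- The zero-sum quadruples of distinct nonzero elements are `l • (a, a + 1, b, b + 1)` with
`l ≠ 0`. With `A = a ^ 2 + a` and `B = b ^ 2 + b`, the entries are nonzero and distinct
exactly when `A`, `B` and `A + B` are nonzero, and the seventh powers add up to `l ^ 7 * (A + B) * (A ^ 2 + A * B + B ^ 2 + 1)`. -/
theorem card_quadruples :
    (({f : Fin 4 ↪ F | (∀ i, f i ≠ 0) ∧ ∑ i, f i = 0 ∧ ∑ i, f i ^ 7 = 0} :
        Finset (Fin 4 ↪ F)).card : ℤ) = (Fintype.card F - 1) *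
      ∑ a : F, ∑ b : F, (if (a ^ 2 + a) ^ 2 + (a ^ 2 + a) * (b ^ 2 + b) + (b ^ 2 + b) ^ 2 = 1 ∧
        a ^ 2 + a ≠ 0 ∧ b ^ 2 + b ≠ 0 ∧ a ^ 2 + a ≠ b ^ 2 + b then 1 else 0 : ℤ) := by
  have := charP_two_of_algebra F
  rw [← Fintype.sum_prod_type' (f := fun a b : F => if (a ^ 2 + a) ^ 2 +
    (a ^ 2 + a) * (b ^ 2 + b) + (b ^ 2 + b) ^ 2 = 1 ∧
    a ^ 2 + a ≠ 0 ∧ b ^ 2 + b ≠ 0 ∧ a ^ 2 + a ≠ b ^ 2 + b then (1 : ℤ) else 0),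
    Finset.sum_boole, ← cast_card_erase_zero, ← Nat.cast_mul, ← Finset.card_product]
  congr 1
  symm
  have hsum : ∀ l a b : F, l * a + l * (a + 1) + l * b + l * (b + 1) = 0 :=
    fun l a b => by grind
  have hpow : ∀ l a b : F, (l * a) ^ 7 + (l * (a + 1)) ^ 7 + (l * b) ^ 7 + (l * (b + 1)) ^ 7 =
      l ^ 7 * (((a ^ 2 + a) + (b ^ 2 + b)) * ((a ^ 2 + a) ^ 2 + (a ^ 2 + a) * (b ^ 2 + b)
        + (b ^ 2 + b) ^ 2 + 1)) := fun l a b => by grind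
  have hinj : ∀ l a b : F, l ≠ 0 → a ^ 2 + a ≠ b ^ 2 + b →
      Function.Injective ![l * a, l * (a + 1), l * b, l * (b + 1)] := by
    intro l a b hl hab
    have h1 : a ≠ b := by grind
    have h2 : a ≠ b + 1 := by grind
    have h3 : a + 1 ≠ b := by grind
    have h4 := h1.symm
    have h5 := h2.symm
    have h6 := h3.symm
    intro i j hij
    fin_cases i <;> fin_cases j <;> simp_all
  refine Finset.card_bij (fun p hp => ⟨![p.1 * p.2.1, p.1 * (p.2.1 + 1), p.1 * p.2.2,
    p.1 * (p.2.2 + 1)], hinj p.1 p.2.1 p.2.2 ?_ ?_⟩) ?_ ?_ ?_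
  · exact (Finset.mem_erase.mp (Finset.mem_product.mp hp).1).1
  · exact (Finset.mem_filter.mp (Finset.mem_product.mp hp).2).2.2.2.2
  · rintro ⟨l, a, b⟩ hp
    have hl : l ≠ 0 := (Finset.mem_erase.mp (Finset.mem_product.mp hp).1).1
    obtain ⟨hQ, hA, hB, -⟩ := (Finset.mem_filter.mp (Finset.mem_product.mp hp).2).2
    simp only at hQ hA hB
    have ha0 : a ≠ 0 := by grind
    have ha1 : a + 1 ≠ 0 := by grind
    have hb0 : b ≠ 0 := by grind
    have hb1 : b + 1 ≠ 0 := by grind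
    simp only [Finset.mem_filter, Finset.mem_univ, true_and, Function.Embedding.coeFn_mk,
      Fin.forall_fin_succ, Fin.sum_univ_four]
    refine ⟨by simp [hl, ha0, ha1, hb0, hb1], hsum l a b, (hpow l a b).trans ?_⟩
    rw [hQ, CharTwo.add_self_eq_zero]
    ring
  · rintro ⟨l, a, b⟩ hp ⟨l', a', b'⟩ _ h
    have hl : l ≠ 0 := (Finset.mem_erase.mp (Finset.mem_product.mp hp).1).1
    have h0 : l * a = l' * a' := DFunLike.congr_fun h 0
    have h1 : l * (a + 1) = l' * (a' + 1) := DFunLike.congr_fun h 1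
    have h2 : l * b = l' * b' := DFunLike.congr_fun h 2
    have hll : l = l' := by linear_combination h1 - h0
    subst hll
    rw [mul_left_cancel₀ hl h0, mul_left_cancel₀ hl h2]
  · intro f hf
    obtain ⟨hne, hs, hs7⟩ := (Finset.mem_filter.mp hf).2
    rw [Fin.sum_univ_four] at hs hs7
    have hf01 : f 0 ≠ f 1 := f.injective.ne (by decide)
    have hf02 : f 0 ≠ f 2 := f.injective.ne (by decide)
    have hf03 : f 0 ≠ f 3 := f.injective.ne (by decide)
    -- Since the sum is zero, `l = f 0 + f 1 = f 2 + f 3`.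
    obtain ⟨l, hl⟩ : ∃ l, l = f 0 + f 1 := ⟨_, rfl⟩
    have hl0 : l ≠ 0 := by grind
    obtain ⟨a, ha⟩ : ∃ a, f 0 = l * a := ⟨f 0 / l, (mul_div_cancel₀ _ hl0).symm⟩
    obtain ⟨b, hb⟩ : ∃ b, f 2 = l * b := ⟨f 2 / l, (mul_div_cancel₀ _ hl0).symm⟩
    have ha' : f 1 = l * (a + 1) := by grind
    have hb' : f 3 = l * (b + 1) := by grind
    have hA : a ^ 2 + a ≠ 0 := by
      intro h
      have h : a * (a + 1) = 0 := by rw [← h]; ring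
      rcases mul_eq_zero.mp h with h | h
      · exact hne 0 (by rw [ha, h, mul_zero])
      · exact hne 1 (by rw [ha', h, mul_zero])
    have hB : b ^ 2 + b ≠ 0 := by
      intro h
      have h : b * (b + 1) = 0 := by rw [← h]; ring
      rcases mul_eq_zero.mp h with h | h
      · exact hne 2 (by rw [hb, h, mul_zero])
      · exact hne 3 (by rw [hb', h, mul_zero])
    have hAB : a ^ 2 + a ≠ b ^ 2 + b := by
      intro h
      have h : (a - b) * (a - (b + 1)) = 0 := by grind
      rcases mul_eq_zero.mp h with h | h
      · exact hf02 (by rw [ha, hb, sub_eq_zero.mp h])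
      · exact hf03 (by rw [ha, hb', sub_eq_zero.mp h])
    rw [ha, ha', hb, hb', hpow] at hs7
    have hQ : (a ^ 2 + a) ^ 2 + (a ^ 2 + a) * (b ^ 2 + b) + (b ^ 2 + b) ^ 2 = 1 := by
      rcases mul_eq_zero.mp hs7 with h | h
      · exact absurd h (pow_ne_zero 7 hl0)
      rcases mul_eq_zero.mp h with h | h
      · exact absurd (CharTwo.add_eq_zero.mp h) hAB
      · exact CharTwo.add_eq_zero.mp h
    refine ⟨(l, a, b), ?_, ?_⟩
    · simp only [Finset.mem_product, Finset.mem_erase, Finset.mem_filter, Finset.mem_univ]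
      exact ⟨⟨hl0, trivial⟩, trivial, hQ, hA, hB, hAB⟩
    · ext i
      fin_cases i
      · exact ha.symm
      · exact ha'.symm
      · exact hb.symm
      · exact hb'.symm

end LowWeight

theorem mainTheorem11 {F : Type*} [Field F] [Fintype F] [Algebra (ZMod 2) F]
    (n : ℕ) (hF : Fintype.card F = 2 ^ n)
    (α : F) (hα : IsPrimitiveRoot α (2 ^ n - 1)) :
    (Odd n →
      numCodewordsOfWeight (binaryCyclicCode (2 ^ n - 1) α {1, 7}) 3 = 0 ∧
      (numCodewordsOfWeight (binaryCyclicCode (2 ^ n - 1) α {1, 7}) 4 : ℚ) =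
        (2 ^ n - 1) * (((2 : ℚ) ^ ((n : ℤ) - 2) + 1) / 6
          - (binaryKloostermanSum (1 : F) : ℚ) / 8)) ∧
    (Even n →
      (numCodewordsOfWeight (binaryCyclicCode (2 ^ n - 1) α {1, 7}) 3 : ℚ) = (2 ^ n - 1) / 3 ∧
      (numCodewordsOfWeight (binaryCyclicCode (2 ^ n - 1) α {1, 7}) 4 : ℚ) =
        (2 ^ n - 1) * (((2 : ℚ) ^ ((n : ℤ) - 2) - 4) / 6
          + (binaryKloostermanSum (1 : F) : ℚ) / 8)) := by
  classical
  have hN : Fintype.card F = 2 ^ n - 1 + 1 := by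
    rw [hF, Nat.sub_add_cancel Nat.one_le_two_pow]
  have h3 : (numCodewordsOfWeight (binaryCyclicCode (2 ^ n - 1) α {1, 7}) 3 : ℤ) * 6 =
      (2 ^ n - 1) * (1 + traceSign (1 : F)) := by
    have h := numCodewordsOfWeight_mul_factorial hN hα 7 3
    zify at h
    rw [card_triples, hF] at h
    exact_mod_cast h
  have h4 : (numCodewordsOfWeight (binaryCyclicCode (2 ^ n - 1) α {1, 7}) 4 : ℤ) * 24 =
      (2 ^ n - 1) * (2 ^ n - traceSign (1 : F)
        + 3 * traceSign (1 : F) * (binaryKloostermanSum (1 : F) - 1)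
        - 6 * (1 + traceSign (1 : F))) := by
    have h := numCodewordsOfWeight_mul_factorial hN hα 7 4
    zify at h
    rw [card_quadruples, card_pairs_over_conic, hF] at h
    exact_mod_cast h
  have hpow : (2 : ℚ) ^ ((n : ℤ) - 2) = 2 ^ n / 4 := by
    rw [zpow_sub₀ two_ne_zero, zpow_natCast]
    norm_num
  rw [traceSign_one hF] at h3 h4
  rw [hpow]
  constructor
  · intro hn
    rw [hn.neg_one_pow] at h3 h4
    have h4' := congrArg (Int.cast : ℤ → ℚ) h4
    push_cast at h4'
    constructor
    · simpa using h3
    · linear_combination h4' / 24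
  · intro hn
    rw [hn.neg_one_pow] at h3 h4
    have h3' := congrArg (Int.cast : ℤ → ℚ) h3
    have h4' := congrArg (Int.cast : ℤ → ℚ) h4
    push_cast at h3' h4'
    constructor
    · linear_combination h3' / 6
    · linear_combination h4' / 24
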